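/- Let $S_n$ be the set of permutations of $\{1,\dots,n\}$, written in one-line notation $\tau=\tau_1\cdots\tau_n$. The reduction of a sequence of $k$ distinct integers is the permutation in $S_k$ obtained by replacing its smallest entry by $1$, its second smallest entry by $2$, and so on. For $\tau\in S_n$ with $n\ge 2$, a bifix of $\tau$ is a permutation $\sigma$ such that, for some $1\le i\le n-1$, $\sigma$ is equal both to the reduction of $\tau_1\cdots\tau_i$ and to the reduction of $\tau_{n-i+1}\cdots\tau_n$. The exterior $x(\tau)$ is the longest bifix of $\tau$ (it exists, since $1\in S_1$ is a bifix), and $|x(\tau)|$ denotes its length. Let $\mathbb{E}_n(|x(\tau)|)$ be the expected value of $|x(\tau)|$ for $\tau$ chosen uniformly at random from $S_n$. Theorem. The limit $\lim_{n\to\infty}\mathbb{E}_n(|x(\tau)|)$ exists and $$e-1\le\lim_{n\to\infty}\mathbb{E}_n(|x(\tau)|)\le e.$$ -/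

import Mathlib

open Filter Topology

noncomputable section

namespace ConsecutivePattern

/-- The rank (counted from `0`) of the `i`-th entry among the entries of the sequence `a`. -/
def rank {k n : ℕ} (a : Fin k → Fin n) (i : Fin k) : Fin k :=
  ⟨(Finset.univ.filter fun j => a j < a i).card, by
    have h : (Finset.univ.filter fun j => a j < a i) ⊂ Finset.univ :=
      Finset.filter_ssubset.2 ⟨i, Finset.mem_univ i, lt_irrefl _⟩
    simpa using Finset.card_lt_card h⟩

theorem rank_lt_rank {k n : ℕ} (a : Fin k → Fin n) {i j : Fin k} (h : a i < a j) :
    rank a i < rank a j := by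
  refine Fin.mk_lt_mk.2 (Finset.card_lt_card ?_)
  refine (Finset.ssubset_iff_of_subset ?_).2 ⟨i, by simpa using h, by simp⟩
  intro l hl
  simp only [Finset.mem_filter, Finset.mem_univ, true_and] at hl ⊢
  exact hl.trans h

theorem rank_injective {k n : ℕ} (a : Fin k → Fin n) (ha : Function.Injective a) :
    Function.Injective (rank a) := by
  intro i j hij
  by_contra hne
  rcases lt_or_gt_of_ne (fun h => hne (ha h)) with h | h
  · exact (rank_lt_rank a h).ne hij
  · exact (rank_lt_rank a h).ne' hij

/-- The reduction of a sequence of distinct entries: the smallest entry is replaced by the smallest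
value, the second smallest by the second smallest value, and so on. -/
def red {k n : ℕ} (a : Fin k → Fin n) (ha : Function.Injective a) : Equiv.Perm (Fin k) :=
  Equiv.ofBijective (rank a) (Finite.injective_iff_bijective.1 (rank_injective a ha))

/-- The reduction of the `k` consecutive entries of `τ` at the (zero-based) positions
`s, s + 1, …, s + k - 1`. -/
def subperm {n : ℕ} (τ : Equiv.Perm (Fin n)) (s k : ℕ) (h : s + k ≤ n) : Equiv.Perm (Fin k) :=
  red (fun j : Fin k => τ ⟨s + j, by omega⟩) (by
    intro i j hij
    have h1 := congrArg Fin.val (τ.injective hij)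
    exact Fin.ext (by simpa using h1))

/-- Permutations of all lengths; `⟨n, τ⟩` is the permutation `τ` of length `n`, written with the
letters `0, …, n - 1`. -/
abbrev AnyPerm : Type := Σ n : ℕ, Equiv.Perm (Fin n)

/-- The length of a permutation. -/
def len (τ : AnyPerm) : ℕ := τ.1

/-- `σ` is the reduction of a nonempty initial segment of `τ`. -/
def IsPrefix (σ τ : AnyPerm) : Prop :=
  ∃ (i : ℕ) (_ : 1 ≤ i) (h : i ≤ τ.1), σ = ⟨i, subperm τ.2 0 i (by omega)⟩

/-- `σ` is the reduction of a nonempty final segment of `τ`. -/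
def IsSuffix (σ τ : AnyPerm) : Prop :=
  ∃ (i : ℕ) (_ : 1 ≤ i) (h : i ≤ τ.1), σ = ⟨i, subperm τ.2 (τ.1 - i) i (by omega)⟩

/-- A bifix of `τ` is both a proper prefix and a proper suffix of `τ`. -/
def IsBifix (σ τ : AnyPerm) : Prop :=
  (IsPrefix σ τ ∧ σ ≠ τ) ∧ (IsSuffix σ τ ∧ σ ≠ τ)

/-- `σ` is a bifix of `τ` and no bifix of `τ` is longer. -/
def IsLongestBifix (σ τ : AnyPerm) : Prop :=
  IsBifix σ τ ∧ ∀ ρ : AnyPerm, IsBifix ρ τ → len ρ ≤ len σ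

open Classical in
/-- The exterior of `τ`, i.e. its longest bifix. It exists and is unique when `τ` has length at
least `2`; permutations of length `0` and `1` have no bifix, and get the empty permutation. -/
def exterior (τ : AnyPerm) : AnyPerm :=
  if h : ∃ σ : AnyPerm, IsLongestBifix σ τ then h.choose else ⟨0, 1⟩

theorem IsBifix.len_lt {σ τ : AnyPerm} (h : IsBifix σ τ) : 1 ≤ len σ ∧ len σ < len τ := by
  obtain ⟨⟨⟨i, hi1, hi, rfl⟩, hne⟩, -⟩ := h
  refine ⟨hi1, lt_of_le_of_ne hi ?_⟩
  rintro (rfl : i = τ.1)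
  apply hne
  obtain ⟨n, τ⟩ := τ
  have key : ∀ m : Fin n, rank τ m = τ m := by
    intro m
    have hmono : StrictMono fun x => rank τ (τ.symm x) := by
      intro x y hxy
      exact rank_lt_rank τ (by simpa using hxy)
    have h2 : (fun x => rank τ (τ.symm x)) = id := by
      have := Subsingleton.elim (hmono.orderIsoOfSurjective _
        (Finite.surjective_of_injective hmono.injective)) (OrderIso.refl (Fin n))
      funext x
      exact congrArg (fun e : Fin n ≃o Fin n => e x) this
    simpa using congrFun h2 (τ m)
  simp only [Sigma.mk.injEq, heq_eq_eq, true_and]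
  ext m
  have h3 : subperm τ 0 n (by omega) m = rank τ m := by
    simp [subperm, red]
  rw [h3, key]

theorem exists_isLongestBifix (τ : AnyPerm) (h : 2 ≤ len τ) :
    ∃ σ : AnyPerm, IsLongestBifix σ τ := by
  classical
  have hex : ∃ k, ∃ σ, IsBifix σ τ ∧ len σ = k := by
    have hne : ∀ π : Equiv.Perm (Fin 1), (⟨1, π⟩ : AnyPerm) ≠ τ := by
      rintro π rfl
      simp [len] at h
    refine ⟨1, ⟨1, 1⟩, ⟨⟨⟨1, le_rfl, le_of_lt h, ?_⟩, hne _⟩, ⟨1, le_rfl, le_of_lt h, ?_⟩, hne _⟩, rfl⟩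
    · rw [Subsingleton.elim (subperm τ.2 0 1 _) 1]
    · rw [Subsingleton.elim (subperm τ.2 (τ.1 - 1) 1 _) 1]
  obtain ⟨k, hk⟩ := hex
  have hb : ∀ m, (∃ σ, IsBifix σ τ ∧ len σ = m) → m ≤ len τ := by
    rintro m ⟨σ, hσ, rfl⟩
    exact hσ.len_lt.2.le
  obtain ⟨σ, hσ, hl⟩ := Nat.findGreatest_spec (P := fun m => ∃ σ, IsBifix σ τ ∧ len σ = m)
    (hb k hk) hk
  exact ⟨σ, hσ, fun ρ hρ => hl ▸ Nat.le_findGreatest (hb _ ⟨ρ, hρ, rfl⟩) ⟨ρ, hρ, rfl⟩⟩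

theorem exterior_spec (τ : AnyPerm) (h : 2 ≤ len τ) : IsLongestBifix (exterior τ) τ := by
  have hex := exists_isLongestBifix τ h
  rw [exterior, dif_pos hex]
  exact hex.choose_spec

/-- The expectation of `X τ` for `τ` uniformly distributed on the permutations of length `n`. -/
def expect (n : ℕ) (X : AnyPerm → ℝ) : ℝ :=
  (∑ τ : Equiv.Perm (Fin n), X ⟨n, τ⟩) / (Fintype.card (Equiv.Perm (Fin n)) : ℝ)

end ConsecutivePattern

end

/-! Let `Overlap τ k` be the event that the two end windows of length `k` have the same pattern; the
exterior length is the largest `k < n` for which it occurs. If `2 * k ≤ n` the windows are disjoint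
and their patterns independent and uniform (`mean_subperm_subperm`), so the probability is `1 / k!`.
If `2 * k > n` the overlap forces a period, hence equal patterns on two disjoint windows of length
`n / 3` (`overlapProb_le`), so long overlaps are negligible. Bounding the maximum below by the
number of overlaps gives `∑ 1 / k! = e - 1`; bounding it above by their total length gives `∑ k / k!
= e`. For existence, `meanMatch M` does not depend on `n`, and `meanExt n` exceeds it by at most a
tail of the series for `e` plus a term vanishing with `n`. The limit is `⨆ M, meanMatch M`. -/

namespace ConsecutivePattern

open Finset

/-! ### Order patterns of windows -/

theorem rank_lt_rank_iff {k n : ℕ} (a : Fin k → Fin n) (ha : Function.Injective a) {i j : Fin k} :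
    rank a i < rank a j ↔ a i < a j := by
  refine ⟨fun h => ?_, rank_lt_rank a⟩
  rcases lt_trichotomy (a i) (a j) with h' | h' | h'
  · exact h'
  · rw [ha h'] at h
    exact absurd h (lt_irrefl _)
  · exact absurd h (rank_lt_rank a h').asymm

theorem subperm_lt_iff {n : ℕ} (τ : Equiv.Perm (Fin n)) (s k : ℕ) (h : s + k ≤ n) (i j : Fin k) :
    subperm τ s k h i < subperm τ s k h j ↔
      τ ⟨s + i, by omega⟩ < τ ⟨s + j, by omega⟩ := by
  refine rank_lt_rank_iff (fun j : Fin k => τ ⟨s + j, by omega⟩) ?_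
  intro i j hij
  have h1 := congrArg Fin.val (τ.injective hij)
  exact Fin.ext (by simpa using h1)

/-- The only order automorphism of `Fin k` is the identity, so patterns are compared through
inequalities alone. -/
theorem perm_eq_of_lt_iff {k : ℕ} {α β : Equiv.Perm (Fin k)}
    (h : ∀ i j, α i < α j ↔ β i < β j) : α = β := by
  have hmono : StrictMono fun x => β (α.symm x) := fun x y hxy =>
    (h _ _).1 (by simpa using hxy)
  have h2 := Subsingleton.elim (hmono.orderIsoOfSurjective _
    (Finite.surjective_of_injective hmono.injective)) (OrderIso.refl (Fin k))
  ext i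
  have h3 : β (α.symm (α i)) = α i := congrArg (fun e : Fin k ≃o Fin k => e (α i)) h2
  rw [← h3, Equiv.symm_apply_apply]

theorem subperm_eq_iff {n : ℕ} (τ : Equiv.Perm (Fin n)) (s t k : ℕ) (hs : s + k ≤ n)
    (ht : t + k ≤ n) :
    subperm τ s k hs = subperm τ t k ht ↔ ∀ i j : Fin k,
      τ ⟨s + i, by omega⟩ < τ ⟨s + j, by omega⟩ ↔
        τ ⟨t + i, by omega⟩ < τ ⟨t + j, by omega⟩ := by
  refine ⟨fun h i j => ?_, fun h => perm_eq_of_lt_iff fun i j => ?_⟩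
  · rw [← subperm_lt_iff τ s k hs, ← subperm_lt_iff τ t k ht, h]
  · rw [subperm_lt_iff, subperm_lt_iff, h]

theorem subperm_subperm {n : ℕ} (τ : Equiv.Perm (Fin n)) (s k t l : ℕ) (hs : s + k ≤ n)
    (ht : t + l ≤ k) (h : s + t + l ≤ n) :
    subperm (subperm τ s k hs) t l ht = subperm τ (s + t) l h := by
  refine perm_eq_of_lt_iff fun i j => ?_
  simp only [subperm_lt_iff, add_assoc]

/-- The embedding of `Fin k` into `Fin n` onto the positions `s, …, s + k - 1`. -/
def window {n : ℕ} (s k : ℕ) (h : s + k ≤ n) : Fin k ↪ Fin n :=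
  ⟨fun i => ⟨s + i, by omega⟩, fun i j hij => Fin.ext (by simpa using congrArg Fin.val hij)⟩

theorem subperm_mul_viaEmbedding {n : ℕ} (τ : Equiv.Perm (Fin n)) (s k : ℕ) (h : s + k ≤ n)
    (σ : Equiv.Perm (Fin k)) :
    subperm (τ * σ.viaEmbedding (window s k h)) s k h = subperm τ s k h * σ := by
  refine perm_eq_of_lt_iff fun i j => ?_
  have hw : ∀ i : Fin k, σ.viaEmbedding (window s k h) ⟨s + i, by omega⟩ = ⟨s + σ i, by omega⟩ :=
    fun i => σ.viaEmbedding_apply (window s k h) i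
  rw [subperm_lt_iff, Equiv.Perm.mul_apply, Equiv.Perm.mul_apply, Equiv.Perm.mul_apply,
    Equiv.Perm.mul_apply, subperm_lt_iff, hw, hw]

theorem subperm_mul_viaEmbedding_of_disjoint {n : ℕ} (τ : Equiv.Perm (Fin n)) (s k t l : ℕ)
    (h : s + k ≤ n) (h' : t + l ≤ n) (hd : s + k ≤ t ∨ t + l ≤ s) (σ : Equiv.Perm (Fin k)) :
    subperm (τ * σ.viaEmbedding (window s k h)) t l h' = subperm τ t l h' := by
  refine perm_eq_of_lt_iff fun i j => ?_
  have hw : ∀ i : Fin l, σ.viaEmbedding (window s k h) ⟨t + i, by omega⟩ = ⟨t + i, by omega⟩ := by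
    refine fun i => σ.viaEmbedding_apply_of_notMem (window s k h) _ ?_
    rintro ⟨x, hx⟩
    have : s + (x : ℕ) = t + i := congrArg Fin.val hx
    omega
  rw [subperm_lt_iff, Equiv.Perm.mul_apply, Equiv.Perm.mul_apply, subperm_lt_iff, hw, hw]

/-! ### Means and independence of disjoint windows -/

/-- The mean of a function on the permutations of length `n`. -/
noncomputable def mean (n : ℕ) (f : Equiv.Perm (Fin n) → ℝ) : ℝ :=
  (∑ τ, f τ) / (Fintype.card (Equiv.Perm (Fin n)) : ℝ)

theorem mean_mono {n : ℕ} {f g : Equiv.Perm (Fin n) → ℝ} (h : ∀ τ, f τ ≤ g τ) :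
    mean n f ≤ mean n g :=
  div_le_div_of_nonneg_right (sum_le_sum fun τ _ => h τ) (Nat.cast_nonneg _)

theorem mean_add {n : ℕ} (f g : Equiv.Perm (Fin n) → ℝ) :
    mean n (fun τ => f τ + g τ) = mean n f + mean n g := by
  simp only [mean, sum_add_distrib, add_div]

theorem mean_sum {ι : Type*} {n : ℕ} (s : Finset ι) (f : ι → Equiv.Perm (Fin n) → ℝ) :
    mean n (fun τ => ∑ i ∈ s, f i τ) = ∑ i ∈ s, mean n (f i) := by
  simp only [mean]
  rw [sum_comm, sum_div]

theorem mean_const_mul {n : ℕ} (c : ℝ) (f : Equiv.Perm (Fin n) → ℝ) :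
    mean n (fun τ => c * f τ) = c * mean n f := by
  simp only [mean, ← mul_sum, mul_div_assoc]

theorem sum_mul_right_mul_right {k l : ℕ} (G : Equiv.Perm (Fin k) → Equiv.Perm (Fin l) → ℝ)
    (α : Equiv.Perm (Fin k)) (β : Equiv.Perm (Fin l)) :
    ∑ σ, ∑ ρ, G (α * σ) (β * ρ) = ∑ σ, ∑ ρ, G σ ρ := by
  rw [← Equiv.sum_comp (Equiv.mulLeft α) fun σ => ∑ ρ, G σ ρ]
  refine sum_congr rfl fun σ _ => ?_
  exact Equiv.sum_comp (Equiv.mulLeft β) fun ρ => G (α * σ) ρ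

/-- The reductions of two disjoint windows of a random permutation are independent and uniform. -/
theorem mean_subperm_subperm {n : ℕ} (s k t l : ℕ) (hs : s + k ≤ n) (ht : t + l ≤ n)
    (hd : s + k ≤ t) (G : Equiv.Perm (Fin k) → Equiv.Perm (Fin l) → ℝ) :
    mean n (fun τ => G (subperm τ s k hs) (subperm τ t l ht)) =
      mean k fun σ => mean l fun ρ => G σ ρ := by
  -- Rearranging entries inside the two windows is a bijection of the permutations `τ` that
  -- translates the pair of patterns by `(σ, ρ)`; averaging over all `(σ, ρ)` then makes the pair
  -- uniform.
  have hshift : ∀ σ ρ, ∑ τ : Equiv.Perm (Fin n), G (subperm τ s k hs) (subperm τ t l ht) =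
      ∑ τ : Equiv.Perm (Fin n), G (subperm τ s k hs * σ) (subperm τ t l ht * ρ) := by
    intro σ ρ
    rw [← Equiv.sum_comp (Equiv.mulRight
      (σ.viaEmbedding (window s k hs) * ρ.viaEmbedding (window t l ht)))]
    refine sum_congr rfl fun τ _ => ?_
    simp only [Equiv.coe_mulRight]
    rw [← mul_assoc, subperm_mul_viaEmbedding_of_disjoint _ t l s k ht hs (Or.inr hd),
      subperm_mul_viaEmbedding, subperm_mul_viaEmbedding,
      subperm_mul_viaEmbedding_of_disjoint _ s k t l hs ht (Or.inl hd)]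
  have hsum : (Fintype.card (Equiv.Perm (Fin k)) : ℝ) * (Fintype.card (Equiv.Perm (Fin l)) *
        ∑ τ : Equiv.Perm (Fin n), G (subperm τ s k hs) (subperm τ t l ht)) =
      Fintype.card (Equiv.Perm (Fin n)) * ∑ σ, ∑ ρ, G σ ρ := by
    calc _ = ∑ _σ : Equiv.Perm (Fin k), ∑ _ρ : Equiv.Perm (Fin l),
          ∑ τ : Equiv.Perm (Fin n), G (subperm τ s k hs) (subperm τ t l ht) := by
          simp only [sum_const, nsmul_eq_mul, card_univ]
      _ = ∑ σ, ∑ ρ, ∑ τ : Equiv.Perm (Fin n),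
          G (subperm τ s k hs * σ) (subperm τ t l ht * ρ) :=
          sum_congr rfl fun σ _ => sum_congr rfl fun ρ _ => hshift σ ρ
      _ = ∑ τ : Equiv.Perm (Fin n), ∑ σ, ∑ ρ,
          G (subperm τ s k hs * σ) (subperm τ t l ht * ρ) := by
          rw [sum_comm]
          conv_rhs => rw [sum_comm' (t' := univ) (s' := fun _ => univ) (by simp)]
          rw [sum_comm]
          exact sum_congr rfl fun σ _ => sum_comm
      _ = ∑ _τ : Equiv.Perm (Fin n), ∑ σ, ∑ ρ, G σ ρ :=
          sum_congr rfl fun τ _ => sum_mul_right_mul_right G _ _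
      _ = _ := by simp only [sum_const, nsmul_eq_mul, card_univ]
  have hk : (Fintype.card (Equiv.Perm (Fin k)) : ℝ) ≠ 0 := Nat.cast_ne_zero.2 Fintype.card_ne_zero
  have hl : (Fintype.card (Equiv.Perm (Fin l)) : ℝ) ≠ 0 := Nat.cast_ne_zero.2 Fintype.card_ne_zero
  have hn : (Fintype.card (Equiv.Perm (Fin n)) : ℝ) ≠ 0 := Nat.cast_ne_zero.2 Fintype.card_ne_zero
  simp only [mean]
  rw [← sum_div, div_div, div_eq_div_iff hn (mul_ne_zero hl hk), mul_comm _ (_ : ℝ),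
    mul_comm (∑ σ, ∑ ρ, G σ ρ), ← hsum]
  ring

theorem mean_subperm_eq {n : ℕ} (s t k : ℕ) (hs : s + k ≤ n) (ht : t + k ≤ n) (hd : s + k ≤ t) :
    mean n (fun τ => if subperm τ s k hs = subperm τ t k ht then (1 : ℝ) else 0) =
      1 / (k.factorial : ℝ) := by
  rw [mean_subperm_subperm s k t k hs ht hd fun σ ρ => if σ = ρ then (1 : ℝ) else 0]
  have hk : (Fintype.card (Equiv.Perm (Fin k)) : ℝ) ≠ 0 := Nat.cast_ne_zero.2 Fintype.card_ne_zero
  simp only [mean, sum_ite_eq, mem_univ, if_true, sum_const, nsmul_eq_mul, card_univ]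
  rw [mul_div_cancel_left₀ _ hk, Fintype.card_perm, Fintype.card_fin]

/-! ### Overlaps, bifixes and overlap probabilities -/

/-- The first `k` and the last `k` entries of `τ` have the same reduction. -/
def Overlap {n : ℕ} (τ : Equiv.Perm (Fin n)) (k : ℕ) : Prop :=
  ∃ h : k ≤ n, subperm τ 0 k (by omega) = subperm τ (n - k) k (by omega)

theorem isBifix_of_overlap {n : ℕ} (τ : Equiv.Perm (Fin n)) {k : ℕ} (hk : 1 ≤ k) (hkn : k < n)
    (h : Overlap τ k) : IsBifix ⟨k, subperm τ 0 k (by omega)⟩ ⟨n, τ⟩ := by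
  have hne : (⟨k, subperm τ 0 k (by omega)⟩ : AnyPerm) ≠ ⟨n, τ⟩ := fun he =>
    hkn.ne (congrArg Sigma.fst he)
  obtain ⟨_, h⟩ := h
  refine ⟨⟨⟨k, hk, hkn.le, rfl⟩, hne⟩, ⟨⟨k, hk, hkn.le, ?_⟩, hne⟩⟩
  exact congrArg (Sigma.mk k) h

theorem IsBifix.overlap {n : ℕ} {τ : Equiv.Perm (Fin n)} {σ : AnyPerm} (h : IsBifix σ ⟨n, τ⟩) :
    Overlap τ (len σ) := by
  obtain ⟨⟨⟨i, -, hi, rfl⟩, -⟩, ⟨⟨j, -, hj, he⟩, -⟩⟩ := h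
  obtain rfl : i = j := congrArg Sigma.fst he
  exact ⟨hi, eq_of_heq (Sigma.mk.inj he).2⟩

/-- The length of the exterior of `τ`. -/
noncomputable def extLen {n : ℕ} (τ : Equiv.Perm (Fin n)) : ℕ := len (exterior ⟨n, τ⟩)

theorem extLen_spec {n : ℕ} (hn : 2 ≤ n) (τ : Equiv.Perm (Fin n)) :
    1 ≤ extLen τ ∧ extLen τ < n ∧ Overlap τ (extLen τ) :=
  have h := (exterior_spec ⟨n, τ⟩ hn).1
  ⟨h.len_lt.1, h.len_lt.2, h.overlap⟩

theorem le_extLen {n : ℕ} (τ : Equiv.Perm (Fin n)) {k : ℕ} (hk : 1 ≤ k) (hkn : k < n)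
    (h : Overlap τ k) : k ≤ extLen τ :=
  (exterior_spec ⟨n, τ⟩ (by change 2 ≤ n; omega)).2 _ (isBifix_of_overlap τ hk hkn h)

open Classical in
/-- The probability that the first `k` and last `k` entries have the same reduction. -/
noncomputable def overlapProb (n k : ℕ) : ℝ :=
  mean n fun τ => if Overlap τ k then 1 else 0

theorem overlapProb_of_two_mul_le {n k : ℕ} (h : 2 * k ≤ n) :
    overlapProb n k = 1 / (k.factorial : ℝ) := by
  rw [← mean_subperm_eq (n := n) 0 (n - k) k (by omega) (by omega) (by omega)]
  unfold overlapProb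
  congr 1
  funext τ
  have : Overlap τ k ↔ subperm τ 0 k (by omega) = subperm τ (n - k) k (by omega) :=
    ⟨fun h => h.2, fun h => ⟨by omega, h⟩⟩
  simp only [this]

/-- An overlap of `τ` with shift `d` is a period of the order pattern, hence so is every
multiple of `d`. -/
theorem Overlap.lt_iff_add_mul {n k : ℕ} {τ : Equiv.Perm (Fin n)} (h : Overlap τ k) (m : ℕ)
    (i j : ℕ) (hi : i + m * (n - k) < n) (hj : j + m * (n - k) < n) :
    τ ⟨i, by omega⟩ < τ ⟨j, by omega⟩ ↔
      τ ⟨i + m * (n - k), hi⟩ < τ ⟨j + m * (n - k), hj⟩ := by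
  obtain ⟨hk, h⟩ := h
  rw [subperm_eq_iff] at h
  induction m with
  | zero => simp
  | succ m ih =>
    have e : (m + 1) * (n - k) = m * (n - k) + (n - k) := by ring
    rw [ih (by omega) (by omega)]
    have := h ⟨i + m * (n - k), by omega⟩ ⟨j + m * (n - k), by omega⟩
    have e1 : ∀ i : ℕ, n - k + (i + m * (n - k)) = i + (m + 1) * (n - k) := fun i => by
      rw [e]; ring
    simpa only [zero_add, e1] using this

/-- A multiple of the period `n - k` must land between `n / 3` and `n - n / 3`, so that the window
of length `n / 3` shifted by it stays in range and is disjoint from the initial one. -/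
theorem exists_multiple {n k : ℕ} (hkn : k < n) (h : n < 2 * k) :
    ∃ m, n / 3 ≤ m * (n - k) ∧ m * (n - k) + n / 3 ≤ n := by
  by_cases hd : n / 3 ≤ n - k
  · exact ⟨1, by omega, by omega⟩
  · have h1 := Nat.div_add_mod (n / 3) (n - k)
    have h2 := Nat.mod_lt (n / 3) (show n - k > 0 by omega)
    -- The first multiple above `n / 3` overshoots by at most `n - k < n / 3`.
    refine ⟨n / 3 / (n - k) + 1, ?_⟩
    have e : (n / 3 / (n - k) + 1) * (n - k) = (n - k) * (n / 3 / (n - k)) + (n - k) := by ring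
    rw [e]
    omega

theorem overlapProb_le {n k : ℕ} (hkn : k < n) (h : n < 2 * k) :
    overlapProb n k ≤ 1 / ((n / 3).factorial : ℝ) := by
  obtain ⟨m, h1, h2⟩ := exists_multiple hkn h
  rw [← mean_subperm_eq 0 (m * (n - k)) (n / 3) (by omega) h2 (by omega)]
  refine mean_mono fun τ => ?_
  by_cases ho : Overlap τ k
  · have : subperm τ 0 (n / 3) (by omega) = subperm τ (m * (n - k)) (n / 3) h2 := by
      rw [subperm_eq_iff]
      intro i j
      have := ho.lt_iff_add_mul m i j (by omega) (by omega)
      simpa only [zero_add, add_comm (m * (n - k))] using this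
    rw [if_pos ho, if_pos this]
  · rw [if_neg ho]
    split_ifs <;> norm_num

/-! ### Truncation to end windows of fixed length -/

open Classical in
/-- The largest `k ≤ M` such that the first `k` entries of `α` and the last `k` entries of `β`
have the same reduction. -/
noncomputable def maxMatch {M : ℕ} (α β : Equiv.Perm (Fin M)) : ℕ :=
  ((range (M + 1)).filter fun k => ∃ _ : k ≤ M,
    subperm α 0 k (by omega) = subperm β (M - k) k (by omega)).sup id

theorem overlap_iff_match {n M k : ℕ} (hn : M ≤ n) (hk : k ≤ M) (τ : Equiv.Perm (Fin n)) :
    Overlap τ k ↔ ∃ _ : k ≤ M, subperm (subperm τ 0 M (by omega)) 0 k (by omega) =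
      subperm (subperm τ (n - M) M (by omega)) (M - k) k (by omega) := by
  have e : n - M + (M - k) = n - k := by omega
  have h1 : subperm (subperm τ 0 M (by omega)) 0 k (by omega) = subperm τ 0 k (by omega) :=
    subperm_subperm τ 0 M 0 k _ _ _
  have h2 : subperm (subperm τ (n - M) M (by omega)) (M - k) k (by omega) =
      subperm τ (n - k) k (by omega) := by
    rw [subperm_subperm τ (n - M) M (M - k) k _ _ (by omega)]
    simp only [e]
  rw [h1, h2]
  exact ⟨fun h => ⟨hk, h.2⟩, fun h => ⟨by omega, h.2⟩⟩

theorem maxMatch_le_extLen {n M : ℕ} (hn : 2 ≤ n) (hM : 2 * M ≤ n) (τ : Equiv.Perm (Fin n)) :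
    maxMatch (subperm τ 0 M (by omega)) (subperm τ (n - M) M (by omega)) ≤ extLen τ := by
  refine Finset.sup_le fun k hk => ?_
  rw [mem_filter, mem_range] at hk
  change k ≤ extLen τ
  rcases Nat.eq_zero_or_pos k with rfl | h0
  · exact Nat.zero_le _
  · exact le_extLen τ h0 (by omega) ((overlap_iff_match (by omega) (by omega) τ).2 hk.2)

-- Either the exterior has length at most `M` and is seen by the end windows, or its length is
-- itself a term of the sum.
open Classical in
theorem extLen_le {n M : ℕ} (hn : 2 ≤ n) (hM : 2 * M ≤ n) (τ : Equiv.Perm (Fin n)) :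
    (extLen τ : ℝ) ≤
      maxMatch (subperm τ 0 M (by omega)) (subperm τ (n - M) M (by omega)) +
        ∑ k ∈ Ico (M + 1) n, (k : ℝ) * if Overlap τ k then 1 else 0 := by
  obtain ⟨-, h2, h3⟩ := extLen_spec hn τ
  have hnn : ∀ k ∈ Ico (M + 1) n, (0 : ℝ) ≤ (k : ℝ) * if Overlap τ k then 1 else 0 := by
    intro k _
    split_ifs <;> simp
  by_cases h : extLen τ ≤ M
  · have h4 : extLen τ ≤ maxMatch (subperm τ 0 M (by omega)) (subperm τ (n - M) M (by omega)) := by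
      refine Finset.le_sup (f := id) (b := extLen τ) ?_
      rw [mem_filter, mem_range]
      exact ⟨by omega, (overlap_iff_match (by omega) h τ).1 h3⟩
    have := sum_nonneg hnn
    have h5 := (Nat.cast_le (α := ℝ)).2 h4
    linarith
  · have h4 := single_le_sum hnn (mem_Ico.2 ⟨by omega, h2⟩ : extLen τ ∈ Ico (M + 1) n)
    rw [if_pos h3, mul_one] at h4
    have h5 : (0 : ℝ) ≤ maxMatch (subperm τ 0 M (by omega)) (subperm τ (n - M) M (by omega)) :=
      Nat.cast_nonneg _
    linarith

open Classical in
theorem sum_overlap_le_extLen {n M : ℕ} (hn : 2 ≤ n) (hM : 2 * M ≤ n) (τ : Equiv.Perm (Fin n)) :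
    ∑ k ∈ Ico 1 (M + 1), (if Overlap τ k then (1 : ℝ) else 0) ≤ extLen τ := by
  rw [sum_boole, Nat.cast_le]
  calc _ ≤ (Icc 1 (extLen τ)).card := by
        refine card_le_card fun k hk => ?_
        rw [mem_filter, mem_Ico] at hk
        exact mem_Icc.2 ⟨hk.1.1, le_extLen τ hk.1.1 (by omega) hk.2⟩
    _ = extLen τ := by simp

/-- The mean of the longest match between two independent uniform permutations of length `M`. -/
noncomputable def meanMatch (M : ℕ) : ℝ := mean M fun α => mean M fun β => (maxMatch α β : ℝ)

/-- The mean length of the exterior. -/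
noncomputable def meanExt (n : ℕ) : ℝ := mean n fun τ => (extLen τ : ℝ)

theorem mean_maxMatch {n M : ℕ} (hM : 2 * M ≤ n) :
    mean n (fun τ => (maxMatch (subperm τ 0 M (by omega)) (subperm τ (n - M) M (by omega)) : ℝ)) =
      meanMatch M :=
  mean_subperm_subperm 0 M (n - M) M (by omega) (by omega) (by omega) fun α β => (maxMatch α β : ℝ)

theorem meanMatch_le_meanExt {n M : ℕ} (hn : 2 ≤ n) (hM : 2 * M ≤ n) :
    meanMatch M ≤ meanExt n := by
  rw [← mean_maxMatch hM]
  exact mean_mono fun τ => Nat.cast_le.2 (maxMatch_le_extLen hn hM τ)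

/-! ### Estimates by the series for `e`, and the limit -/

/-- The partial sums of the series for `e`. -/
noncomputable def expSum (M : ℕ) : ℝ := ∑ i ∈ range M, 1 / (i.factorial : ℝ)

theorem expSum_le (M : ℕ) : expSum M ≤ Real.exp 1 := by
  simpa [expSum] using Real.sum_le_exp_of_nonneg zero_le_one M

theorem tendsto_expSum : Tendsto expSum atTop (𝓝 (Real.exp 1)) := by
  have h := (NormedSpace.expSeries_div_hasSum_exp (1 : ℝ)).tendsto_sum_nat
  rw [← Real.exp_eq_exp_ℝ] at h
  exact h.congr fun n => show _ = expSum n by simp [expSum]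

theorem expSum_sub_one_le_meanExt {n M : ℕ} (hn : 2 ≤ n) (hM : 2 * M ≤ n) :
    expSum (M + 1) - 1 ≤ meanExt n := by
  classical
  calc expSum (M + 1) - 1 = ∑ k ∈ Ico 1 (M + 1), overlapProb n k := by
        rw [expSum, range_eq_Ico, sum_eq_sum_Ico_succ_bot (by omega)]
        rw [sum_congr rfl fun k hk => overlapProb_of_two_mul_le (n := n) (k := k)
          (by rw [mem_Ico] at hk; omega)]
        simp
    _ = mean n fun τ => ∑ k ∈ Ico 1 (M + 1), (if Overlap τ k then (1 : ℝ) else 0) :=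
        (mean_sum _ _).symm
    _ ≤ meanExt n := mean_mono fun τ => sum_overlap_le_extLen hn hM τ

theorem sum_mul_overlapProb_le {n M : ℕ} (hM : 2 * M ≤ n) :
    ∑ k ∈ Ico (M + 1) n, (k : ℝ) * overlapProb n k ≤
      Real.exp 1 - expSum M + (n : ℝ) ^ 2 / ((n / 3).factorial : ℝ) := by
  -- Short overlaps contribute `k / k! = 1 / (k - 1)!`; the fewer than `n` long ones contribute at
  -- most `n / (n / 3)!` each.
  have hterm : ∀ k ∈ Ico (M + 1) n, (k : ℝ) * overlapProb n k ≤
      (if 2 * k ≤ n then 1 / ((k - 1).factorial : ℝ) else 0) +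
        (n : ℝ) / ((n / 3).factorial : ℝ) := by
    intro k hk
    rw [mem_Ico] at hk
    have h0 : (0 : ℝ) ≤ (n : ℝ) / ((n / 3).factorial : ℝ) := by positivity
    split_ifs with h
    · rw [overlapProb_of_two_mul_le h]
      obtain ⟨j, rfl⟩ : ∃ j, k = j + 1 := ⟨k - 1, by omega⟩
      have hj : ((j + 1 : ℕ) : ℝ) ≠ 0 := by positivity
      have hj' : (j.factorial : ℝ) ≠ 0 := by positivity
      have : ((j + 1 : ℕ) : ℝ) * (1 / ((j + 1).factorial : ℝ)) = 1 / (j.factorial : ℝ) := by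
        rw [Nat.factorial_succ, Nat.cast_mul]
        field_simp
      rw [this, Nat.add_sub_cancel]
      linarith
    · have hp := overlapProb_le hk.2 (by omega)
      have hkn : (k : ℝ) ≤ n := Nat.cast_le.2 hk.2.le
      calc (k : ℝ) * overlapProb n k ≤ k * (1 / ((n / 3).factorial : ℝ)) :=
            mul_le_mul_of_nonneg_left hp (Nat.cast_nonneg _)
        _ ≤ n * (1 / ((n / 3).factorial : ℝ)) :=
            mul_le_mul_of_nonneg_right hkn (by positivity)
        _ = _ := by ring
  refine (sum_le_sum hterm).trans ?_
  rw [sum_add_distrib]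
  refine add_le_add ?_ ?_
  · rw [← sum_filter]
    calc _ ≤ ∑ k ∈ Ico (M + 1) (n + 1), 1 / ((k - 1).factorial : ℝ) := by
          refine sum_le_sum_of_subset_of_nonneg (fun k hk => ?_) fun _ _ _ => by positivity
          rw [mem_filter, mem_Ico] at hk
          exact mem_Ico.2 ⟨hk.1.1, by omega⟩
      _ = ∑ k ∈ Ico M n, 1 / (k.factorial : ℝ) := by
          rw [← sum_Ico_add' (fun k => 1 / ((k - 1).factorial : ℝ)) M n 1]
          simp
      _ = expSum n - expSum M := sum_Ico_eq_sub _ (by omega)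
      _ ≤ _ := sub_le_sub_right (expSum_le n) _
  · rw [sum_const, nsmul_eq_mul, Nat.card_Ico, pow_two, mul_div_assoc]
    exact mul_le_mul_of_nonneg_right (Nat.cast_le.2 (by omega)) (by positivity)

theorem meanExt_le {n M : ℕ} (hn : 2 ≤ n) (hM : 2 * M ≤ n) :
    meanExt n ≤
      meanMatch M + (Real.exp 1 - expSum M) + (n : ℝ) ^ 2 / ((n / 3).factorial : ℝ) := by
  classical
  have h := mean_mono fun τ => extLen_le hn hM τ
  rw [mean_add, mean_maxMatch hM, mean_sum] at h
  simp only [mean_const_mul] at h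
  have h2 := sum_mul_overlapProb_le hM
  simp only [overlapProb] at h2
  unfold meanExt
  linarith

theorem tendsto_sq_div_factorial_div_three :
    Tendsto (fun n : ℕ => (n : ℝ) ^ 2 / ((n / 3).factorial : ℝ)) atTop (𝓝 0) := by
  have h1 : Tendsto (fun n : ℕ => 9 * ((4 : ℝ) ^ (n / 3) / ((n / 3).factorial : ℝ))) atTop
      (𝓝 0) := by
    have := ((FloorSemiring.tendsto_pow_div_factorial_atTop (4 : ℝ)).comp
      (Nat.tendsto_div_const_atTop (show 3 ≠ 0 by norm_num))).const_mul 9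
    simpa using this
  refine squeeze_zero (fun n => by positivity) (fun n => ?_) h1
  rw [← mul_div_assoc]
  refine div_le_div_of_nonneg_right ?_ (Nat.cast_nonneg _)
  -- From `n < 3 * (n / 3 + 1)` and `n / 3 + 1 ≤ 2 ^ (n / 3)`.
  have h2 : n ≤ 3 * 2 ^ (n / 3) := by
    have := Nat.lt_two_pow_self (n := n / 3)
    omega
  have h3 : n ^ 2 ≤ 9 * 4 ^ (n / 3) := by
    calc n ^ 2 ≤ (3 * 2 ^ (n / 3)) ^ 2 := Nat.pow_le_pow_left h2 2
      _ = 9 * 4 ^ (n / 3) := by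
        rw [mul_pow, ← pow_mul, mul_comm _ 2, pow_mul]; norm_num
  exact_mod_cast h3

theorem meanMatch_zero : meanMatch 0 = 0 := by
  have h : ∀ α β : Equiv.Perm (Fin 0), maxMatch α β = 0 := fun α β => by
    refine Nat.le_zero.1 (Finset.sup_le fun k hk => ?_)
    rw [mem_filter, mem_range] at hk
    change k ≤ 0
    omega
  simp [meanMatch, mean, h]

theorem exists_tendsto_meanExt :
    ∃ L : ℝ, Tendsto meanExt atTop (𝓝 L) ∧ Real.exp 1 - 1 ≤ L ∧ L ≤ Real.exp 1 := by
  have hub : ∀ M, meanMatch M ≤ Real.exp 1 := by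
    intro M
    have ht : Tendsto (fun n : ℕ => Real.exp 1 + (n : ℝ) ^ 2 / ((n / 3).factorial : ℝ)) atTop
        (𝓝 (Real.exp 1)) := by
      simpa using tendsto_sq_div_factorial_div_three.const_add (Real.exp 1)
    refine ge_of_tendsto ht ?_
    filter_upwards [eventually_ge_atTop (2 * M + 2)] with n hn
    have h1 := meanMatch_le_meanExt (n := n) (M := M) (by omega) (by omega)
    -- With `M = 0` nothing is matched and the whole series for `e` remains as the bound.
    have h2 := meanExt_le (n := n) (M := 0) (by omega) (by omega)
    rw [meanMatch_zero] at h2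
    simp only [expSum, range_zero, sum_empty] at h2
    linarith
  have hbdd : BddAbove (Set.range meanMatch) := ⟨Real.exp 1, by rintro _ ⟨M, rfl⟩; exact hub M⟩
  have hlim : Tendsto meanExt atTop (𝓝 (⨆ M, meanMatch M)) := by
    refine tendsto_order.2 ⟨fun a ha => ?_, fun a ha => ?_⟩
    · obtain ⟨M, hM⟩ := exists_lt_of_lt_ciSup ha
      filter_upwards [eventually_ge_atTop (2 * M + 2)] with n hn
      exact hM.trans_le (meanMatch_le_meanExt (by omega) (by omega))
    · have hε : 0 < (a - ⨆ M, meanMatch M) / 2 := by linarith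
      obtain ⟨M, hM⟩ := (tendsto_expSum.eventually_const_lt
        (show Real.exp 1 - (a - ⨆ M, meanMatch M) / 2 < Real.exp 1 by linarith)).exists
      filter_upwards [eventually_ge_atTop (2 * M + 2),
        tendsto_sq_div_factorial_div_three.eventually_lt_const hε] with n hn hn2
      have h1 := meanExt_le (n := n) (M := M) (by omega) (by omega)
      have h2 := le_ciSup hbdd M
      linarith
  refine ⟨_, hlim, ?_, ciSup_le hub⟩
  refine le_of_tendsto (((tendsto_add_atTop_iff_nat 1).2 tendsto_expSum).sub_const 1) ?_
  refine Eventually.of_forall fun M => ge_of_tendsto hlim ?_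
  filter_upwards [eventually_ge_atTop (2 * M + 2)] with n hn
  exact expSum_sub_one_le_meanExt (by omega) (by omega)

end ConsecutivePattern

theorem theorem6p4 :
    ∃ L : ℝ,
      Tendsto (fun n : ℕ => ConsecutivePattern.expect n
        (fun τ => (ConsecutivePattern.len (ConsecutivePattern.exterior τ) : ℝ))) atTop (𝓝 L) ∧
      Real.exp 1 - 1 ≤ L ∧ L ≤ Real.exp 1 :=
  -- `expect` of the exterior length unfolds to `meanExt`.
  ConsecutivePattern.exists_tendsto_meanExt
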